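/- For an integer $n\ge 0$ let $Q$ be a positive definite symmetric bilinear form on $\mathbb{R}^n$, and let $C\ell(n)=C\ell(\mathbb{R}^n,Q)$ be the real Clifford algebra of $(\mathbb{R}^n,Q)$ with the convention $v\cdot v=-Q(v,v)\,1$ for $v\in\mathbb{R}^n$ (up to isomorphism it does not depend on $Q$). Let $c$ be the anti-automorphism of $C\ell(n)$ with $c(v)=-v$ for all $v\in\mathbb{R}^n$, and let $G_n$ be the group $$G_n=\{g\in C\ell(n) : g\cdot c(g)=c(g)\cdot g=1\}$$ under multiplication. For a positive integer $m$ let $O(m)$, $U(m)$ and $Sp(m)$ be the groups of all $m\times m$ matrices $A$ over $\mathbb{R}$, $\mathbb{C}$ and the quaternions $\mathbb{H}$, respectively, with $AA^*=A^*A=1$, where $A^*$ is the conjugate transpose. Let $k\ge 0$ be an integer. Then there are the following isomorphisms of groups: 1. $G_{8k}\cong O(2^{4k})$; 2. $G_{8k+1}\cong U(2^{4k})$; 3. $G_{8k+2}\cong Sp(2^{4k})$; 4. $G_{8k+3}\cong Sp(2^{4k})\times Sp(2^{4k})$; 5. $G_{8k+4}\cong Sp(2^{4k+1})$; 6. $G_{8k+5}\cong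 U(2^{4k+2})$; 7. $G_{8k+6}\cong O(2^{4k+3})$; 8. $G_{8k+7}\cong O(2^{4k+3})\times O(2^{4k+3})$. In particular, for every $n\ge 0$ the group $G_n$ is compact, as a subset of the finite-dimensional real vector space $C\ell(n)$ with its usual topology. -/

import Mathlib

open scoped Quaternion

noncomputable section

/-- The Clifford algebra `Cℓ(ℝⁿ, Q)` with the sign convention `v * v = -Q(v)` for `v ∈ ℝⁿ`.
Mathlib's `CliffordAlgebra q` is the universal algebra with `v * v = q(v)`, so `q = -Q`.
Here `Q(v)` stands for `Q(v, v)` if `Q` is given as a symmetric bilinear form. -/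
abbrev Cl {n : ℕ} (Q : QuadraticForm ℝ (Fin n → ℝ)) : Type :=
  CliffordAlgebra (-Q)

/-- The canonical topology of the finite dimensional real vector space `Cℓ(ℝⁿ, Q)`. -/
instance Cl.instTopologicalSpace {n : ℕ} (Q : QuadraticForm ℝ (Fin n → ℝ)) :
    TopologicalSpace (Cl Q) :=
  moduleTopology ℝ (Cl Q)

instance Cl.instIsModuleTopology {n : ℕ} (Q : QuadraticForm ℝ (Fin n → ℝ)) :
    IsModuleTopology ℝ (Cl Q) :=
  ⟨rfl⟩

/-- The canonical anti-automorphism `c = α ∘ τ`, where `α` is the automorphism with `α(v) = -v`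
and `τ` the anti-automorphism with `τ(v) = v` for `v ∈ ℝⁿ`. -/
def Cl.conj {n : ℕ} {Q : QuadraticForm ℝ (Fin n → ℝ)} (x : Cl Q) : Cl Q :=
  CliffordAlgebra.involute (CliffordAlgebra.reverse x)

/-- Mathlib's `star` on a Clifford algebra is the anti-automorphism `c`. -/
theorem Cl.star_eq_conj {n : ℕ} {Q : QuadraticForm ℝ (Fin n → ℝ)} (x : Cl Q) :
    star x = Cl.conj x :=
  CliffordAlgebra.star_def' x

/-- The group `{g ∈ Cℓ(ℝⁿ, Q) : g * c(g) = c(g) * g = 1}` under multiplication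
(see `mem_cliffordIsometryGroup_iff`). -/
abbrev cliffordIsometryGroup {n : ℕ} (Q : QuadraticForm ℝ (Fin n → ℝ)) : Submonoid (Cl Q) :=
  unitary (Cl Q)

theorem mem_cliffordIsometryGroup_iff {n : ℕ} {Q : QuadraticForm ℝ (Fin n → ℝ)} {g : Cl Q} :
    g ∈ cliffordIsometryGroup Q ↔ g * Cl.conj g = 1 ∧ Cl.conj g * g = 1 := by
  rw [← Cl.star_eq_conj, Unitary.mem_iff, and_comm]

/-- The compact symplectic group `Sp(m)` of all quaternionic `m × m` matrices `A` with
`A * A^* = A^* * A = 1`, where `A^*` is the conjugate transpose. -/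
abbrev compactSymplecticGroup (m : ℕ) : Submonoid (Matrix (Fin m) (Fin m) ℍ[ℝ]) :=
  unitary (Matrix (Fin m) (Fin m) ℍ[ℝ])

end

/-! With `star = c`, the group in question is the unitary group of the star algebra `Cl Q`. Hence it
suffices to identify `Cl Q` as a star algebra with matrices over ℝ, ℂ or ℍ, or with a product of two
such algebras, where `star` is the conjugate transpose.

Recognition (`CliffordSystem.nonempty_starAlgEquiv`): if a star algebra `A` of dimension 2^n is
generated by n anticommuting skew-adjoint square roots of -1, the universal property gives a
surjective star homomorphism from `Cl Q` to `A`. Ordered products of generators span `Cl Q`, so its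
dimension is at most 2^n and the map is bijective. No basis of the Clifford algebra is needed.

Models (`CliffordSystem.quaternionicExtension`): a system in `A` yields one with four more elements
in M₂(ℍ ⊗ A). Since ℍ ⊗ ℝ = ℍ, ℍ ⊗ ℂ = M₂(ℂ) and ℍ ⊗ ℍ = M₄(ℝ), the models ℝ, ℂ, ℍ, ℍ × ℍ for n = 0,
1, 2, 3 give all others, and two steps give the period 8.

Compactness (`HasFrobeniusForm.isCompact_unitary`): the real part of the trace of x* x is a sum of
squares of coordinates and is constant on unitary elements, so the unitary group is closed and
bounded. -/

open Module

/-! ### Dimension bound for algebras generated by anticommuting square roots of -1 -/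

section span
variable {ι C : Type*} [Ring C] [Algebra ℝ C]

/-- The span of the ordered products of the elements `e i`, where `i` runs through sublists. -/
def orderedProductSpan (e : ι → C) : List ι → Submodule ℝ C
  | [] => Submodule.span ℝ {1}
  | a :: l => orderedProductSpan e l ⊔
      (orderedProductSpan e l).map (LinearMap.mulRight ℝ (e a))

theorem orderedProductSpan_finite_finrank_le (e : ι → C) (l : List ι) :
    Module.Finite ℝ (orderedProductSpan e l) ∧
      finrank ℝ (orderedProductSpan e l) ≤ 2 ^ l.length := by
  induction l with
  | nil =>
    refine ⟨Module.Finite.span_of_finite ℝ (Set.finite_singleton _), ?_⟩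
    exact (finrank_span_le_card (R := ℝ) ({1} : Set C)).trans (by simp)
  | cons a l ih =>
    obtain ⟨h1, h2⟩ := ih
    refine ⟨Submodule.finite_sup _ _, ?_⟩
    have h3 := Submodule.finrank_map_le (LinearMap.mulRight ℝ (e a)) (orderedProductSpan e l)
    refine (Submodule.finrank_add_le_finrank_add_finrank (orderedProductSpan e l)
      ((orderedProductSpan e l).map (LinearMap.mulRight ℝ (e a)))).trans ?_
    rw [List.length_cons, pow_succ]
    omega

theorem one_mem_orderedProductSpan (e : ι → C) (l : List ι) : 1 ∈ orderedProductSpan e l := by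
  induction l with
  | nil => exact Submodule.mem_span_singleton_self 1
  | cons a l ih => exact Submodule.mem_sup_left ih

/-- An element over `a :: l` is y + w e_a with y, w in the span over `l`. Multiplying by e_a swaps
the two summands up to sign; any other e_i is moved past e_a and absorbed by induction. -/
theorem mul_mem_orderedProductSpan {e : ι → C} (hsq : ∀ i, e i * e i = -1)
    (hanti : ∀ i j, i ≠ j → e i * e j = -(e j * e i)) {l : List ι} {i : ι} (hi : i ∈ l)
    {x : C} (hx : x ∈ orderedProductSpan e l) : x * e i ∈ orderedProductSpan e l := by
  induction l generalizing x with
  | nil => simp at hi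
  | cons a l ih =>
    obtain ⟨y, hy, z, hz, rfl⟩ := Submodule.mem_sup.1 hx
    obtain ⟨w, hw, rfl⟩ := Submodule.mem_map.1 hz
    rw [add_mul]
    simp only [LinearMap.mulRight_apply]
    by_cases hia : i = a
    · subst hia
      rw [mul_assoc, hsq, mul_neg_one]
      exact Submodule.add_mem _ (Submodule.mem_sup_right (Submodule.mem_map.2 ⟨y, hy, rfl⟩))
        (Submodule.mem_sup_left (Submodule.neg_mem _ hw))
    · have hil : i ∈ l := by simpa [hia] using hi
      rw [mul_assoc, hanti a i (Ne.symm hia), mul_neg, ← mul_assoc]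
      exact Submodule.add_mem _ (Submodule.mem_sup_left (ih hil hy))
        (Submodule.neg_mem _ (Submodule.mem_sup_right (Submodule.mem_map.2 ⟨_, ih hil hw, rfl⟩)))

/-- The span of ordered products contains 1 and is stable under right multiplication by the
generators, hence by the whole algebra, so it is everything. -/
theorem finite_finrank_le_of_anticommuting_generators [Fintype ι] {e : ι → C}
    (hsq : ∀ i, e i * e i = -1) (hanti : ∀ i j, i ≠ j → e i * e j = -(e j * e i))
    (hgen : Algebra.adjoin ℝ (Set.range e) = ⊤) :
    Module.Finite ℝ C ∧ finrank ℝ C ≤ 2 ^ Fintype.card ι := by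
  set V := orderedProductSpan e (Finset.univ : Finset ι).toList with hV
  have key : ∀ y ∈ Algebra.adjoin ℝ (Set.range e), ∀ x ∈ V, x * y ∈ V := by
    intro y hy
    induction hy using Algebra.adjoin_induction with
    | mem y hy =>
      obtain ⟨i, rfl⟩ := hy
      exact fun x hx => mul_mem_orderedProductSpan hsq hanti (by simp) hx
    | algebraMap r =>
      intro x hx
      rw [← Algebra.commutes, ← Algebra.smul_def]
      exact V.smul_mem r hx
    | add y z _ _ hy hz => exact fun x hx => mul_add x y z ▸ V.add_mem (hy x hx) (hz x hx)
    | mul y z _ _ hy hz => exact fun x hx => mul_assoc x y z ▸ hz _ (hy x hx)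
  have htop : V = ⊤ := by
    refine eq_top_iff.2 fun y _ => ?_
    have := key y (hgen ▸ Algebra.mem_top) 1 (one_mem_orderedProductSpan e _)
    rwa [one_mul] at this
  obtain ⟨h1, h2⟩ := orderedProductSpan_finite_finrank_le e (Finset.univ : Finset ι).toList
  rw [← hV, htop] at h1 h2
  refine ⟨Module.Finite.equiv Submodule.topEquiv, ?_⟩
  simpa using h2

end span

/-! ### Recognition of the Clifford algebra as a star algebra -/

/-- A family of anticommuting skew-adjoint square roots of `-1` which generates a real star
algebra of the dimension of the Clifford algebra. -/
structure CliffordSystem {ι A : Type*} [Fintype ι] [Ring A] [StarRing A] [Algebra ℝ A]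
    (e : ι → A) : Prop where
  sq : ∀ i, e i * e i = -1
  anticomm : ∀ i j, i ≠ j → e i * e j = -(e j * e i)
  star_eq : ∀ i, star (e i) = -e i
  generates : ∀ S : Subalgebra ℝ A, (∀ i, e i ∈ S) → S = ⊤
  finrank_eq : finrank ℝ A = 2 ^ Fintype.card ι

namespace CliffordSystem

theorem reindex {ι κ A : Type*} [Fintype ι] [Fintype κ] [Ring A] [StarRing A] [Algebra ℝ A]
    {e : ι → A} (he : CliffordSystem e) (f : κ ≃ ι) : CliffordSystem (e ∘ f) where
  sq i := he.sq _
  anticomm i j h := he.anticomm _ _ (f.injective.ne h)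
  star_eq i := he.star_eq _
  generates S hS := he.generates S fun i => by simpa using hS (f.symm i)
  finrank_eq := by rw [he.finrank_eq, Fintype.card_congr f]

theorem map {ι A B : Type*} [Fintype ι] [Ring A] [StarRing A] [Algebra ℝ A]
    [Ring B] [StarRing B] [Algebra ℝ B]
    {e : ι → A} (he : CliffordSystem e) (φ : A ≃⋆ₐ[ℝ] B) : CliffordSystem (fun i => φ (e i)) where
  sq i := by rw [← map_mul, he.sq, map_neg, map_one]
  anticomm i j h := by rw [← map_mul, he.anticomm _ _ h, map_neg, map_mul]
  star_eq i := by rw [← map_star, he.star_eq, map_neg]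
  generates S hS := by
    have h := he.generates (S.comap (φ : A ≃⋆ₐ[ℝ] B).toAlgEquiv.toAlgHom) hS
    refine eq_top_iff.2 fun y _ => ?_
    have hy : φ.symm y ∈ S.comap (φ : A ≃⋆ₐ[ℝ] B).toAlgEquiv.toAlgHom := h ▸ Algebra.mem_top
    have h2 : φ (φ.symm y) ∈ S := hy
    rwa [StarAlgEquiv.apply_symm_apply] at h2
  finrank_eq := by
    rw [← he.finrank_eq]
    exact (LinearEquiv.finrank_eq (φ : A ≃⋆ₐ[ℝ] B).toAlgEquiv.toLinearEquiv).symm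

/-- This is the relation demanded by the universal property. Adding the double sum for the square to
its transpose leaves only the diagonal anticommutators, and the resulting factor 2 cancels. -/
theorem sum_smul_mul_self {ι A : Type*} [Fintype ι] [Ring A] [StarRing A] [Algebra ℝ A]
    {e : ι → A} (he : CliffordSystem e) (x : ι → ℝ) :
    (∑ i, x i • e i) * (∑ i, x i • e i) = algebraMap ℝ A (-∑ i, x i * x i) := by
  classical
  set s := ∑ i, x i • e i with hs
  have h1 : s * s = ∑ i, ∑ j, (x i * x j) • (e i * e j) := by
    rw [hs, Finset.sum_mul_sum]
    simp only [smul_mul_smul_comm]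
  have h2 : s * s = ∑ i, ∑ j, (x i * x j) • (e j * e i) := by
    rw [h1, Finset.sum_comm]
    exact Finset.sum_congr rfl fun i _ => Finset.sum_congr rfl fun j _ => by rw [mul_comm (x j)]
  have h3 : (2 : ℝ) • (s * s) = (2 : ℝ) • algebraMap ℝ A (-∑ i, x i * x i) := by
    rw [two_smul]
    nth_rewrite 1 [h1]
    rw [h2, ← Finset.sum_add_distrib]
    simp only [← Finset.sum_add_distrib, ← smul_add]
    have : ∀ i, ∑ j, (x i * x j) • (e i * e j + e j * e i)
        = (2 : ℝ) • algebraMap ℝ A (-(x i * x i)) := by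
      intro i
      rw [Finset.sum_eq_single i]
      · rw [he.sq, Algebra.algebraMap_eq_smul_one, ← two_smul ℝ, smul_smul, smul_smul,
          smul_neg, ← neg_smul]
        congr 1; ring
      · intro j _ hj
        rw [he.anticomm i j hj.symm, neg_add_cancel, smul_zero]
      · simp
    rw [Finset.sum_congr rfl fun i _ => this i, ← Finset.smul_sum, ← map_sum,
      Finset.sum_neg_distrib]
  exact smul_right_injective A (two_ne_zero (α := ℝ)) h3

end CliffordSystem

/-- Sylvester's theorem gives weights in {1, 0, -1}; evaluating at the preimages of the standard
basis vectors rules out 0 and -1. -/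
theorem exists_linearEquiv_sum_mul_self_of_posDef {n : ℕ}
    {Q : QuadraticForm ℝ (Fin n → ℝ)} (hQ : Q.PosDef) :
    ∃ φ : (Fin n → ℝ) ≃ₗ[ℝ] (Fin n → ℝ), ∀ v, Q v = ∑ i, φ v i * φ v i := by
  obtain ⟨w, hw, ⟨φ⟩⟩ := Q.equivalent_one_zero_neg_one_weighted_sum_squared
  have hφ : ∀ v, Q v = ∑ i, w i * (φ v i * φ v i) := fun v => by
    rw [← φ.map_app, QuadraticMap.weightedSumSquares_apply]
    simp only [smul_eq_mul]
  have hw1 : ∀ i, w i = 1 := by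
    intro i
    have h := hQ (φ.toLinearEquiv.symm (Pi.single i 1)) (by simp)
    have h2 : φ (φ.toLinearEquiv.symm (Pi.single i 1)) = Pi.single i 1 :=
      φ.toLinearEquiv.apply_symm_apply _
    rw [hφ, h2] at h
    have h3 : 0 < w i := by simpa [Pi.single_apply] using h
    rcases hw i with h | h | h <;> linarith
  let σ : Fin n ≃ Fin (finrank ℝ (Fin n → ℝ)) := finCongr (finrank_fin_fun ℝ).symm
  refine ⟨φ.toLinearEquiv.trans (LinearEquiv.funCongrLeft ℝ ℝ σ), fun v => ?_⟩
  rw [hφ, ← σ.sum_comp]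
  simp only [hw1, one_mul]
  rfl

/-- The lift `F` respects `star` because both involutions negate the generating vectors. It is onto
by generation, and then bijective because dim `Cl Q` ≤ 2^n = dim `A`. -/
theorem CliffordSystem.nonempty_starAlgEquiv {n : ℕ} {A : Type*} [Ring A] [StarRing A]
    [Algebra ℝ A] [StarModule ℝ A] {e : Fin n → A} (he : CliffordSystem e)
    {Q : QuadraticForm ℝ (Fin n → ℝ)} (hQ : Q.PosDef) :
    Module.Finite ℝ (Cl Q) ∧ Nonempty (Cl Q ≃⋆ₐ[ℝ] A) := by
  obtain ⟨φ, hφ⟩ := exists_linearEquiv_sum_mul_self_of_posDef hQ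
  let f : (Fin n → ℝ) →ₗ[ℝ] A := (Fintype.linearCombination ℝ e) ∘ₗ φ.toLinearMap
  have hf : ∀ v, f v = ∑ i, φ v i • e i := fun v => Fintype.linearCombination_apply ℝ e _
  let F : Cl Q →ₐ[ℝ] A := CliffordAlgebra.lift (-Q) ⟨f, fun v => by
    rw [hf, he.sum_smul_mul_self, neg_apply, hφ]⟩
  have hF : ∀ v, F (CliffordAlgebra.ι (-Q) v) = f v := fun v => CliffordAlgebra.lift_ι_apply _ _ _
  have hFstar : ∀ x, F (star x) = star (F x) := by
    intro x
    induction x using CliffordAlgebra.induction with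
    | algebraMap r =>
      rw [CliffordAlgebra.star_algebraMap, AlgHom.commutes, ← algebraMap_star_comm]
      simp
    | ι v =>
      rw [CliffordAlgebra.star_ι, map_neg, hF, hf, star_sum, ← Finset.sum_neg_distrib]
      exact Finset.sum_congr rfl fun i _ => by
        rw [star_smul, he.star_eq, smul_neg, star_trivial]
    | mul a b ha hb => rw [star_mul, map_mul, map_mul, star_mul, ha, hb]
    | add a b ha hb => rw [star_add, map_add, map_add, star_add, ha, hb]
  have hsurj : Function.Surjective F := by
    rw [← AlgHom.range_eq_top]
    refine he.generates _ fun i => ⟨CliffordAlgebra.ι (-Q) (φ.symm (Pi.single i 1)), ?_⟩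
    change F _ = _
    rw [hF, hf]
    simp [Pi.single_apply]
  -- The image in `Cl Q` of a `Q`-orthonormal basis: orthogonality makes its members anticommute.
  let ε : Fin n → Cl Q := fun i => CliffordAlgebra.ι (-Q) (φ.symm (Pi.single i 1))
  have hfin : Module.Finite ℝ (Cl Q) ∧ finrank ℝ (Cl Q) ≤ 2 ^ Fintype.card (Fin n) := by
    refine finite_finrank_le_of_anticommuting_generators (e := ε) ?_ ?_ ?_
    · intro i
      simp only [ε]
      rw [CliffordAlgebra.ι_sq_scalar, neg_apply, hφ]
      simp [Pi.single_apply]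
    · intro i j hij
      simp only [ε]
      rw [eq_neg_iff_add_eq_zero, CliffordAlgebra.ι_mul_ι_add_swap, QuadraticMap.polar]
      simp only [neg_apply, hφ, map_add, LinearEquiv.apply_symm_apply]
      simp [Pi.single_apply, mul_add, Finset.sum_add_distrib, hij, hij.symm]
    · rw [eq_top_iff, ← CliffordAlgebra.adjoin_range_ι]
      refine Algebra.adjoin_le ?_
      rintro _ ⟨v, rfl⟩
      have : v = ∑ i, φ v i • φ.symm (Pi.single i 1) := by
        apply φ.injective
        ext j
        simp [Pi.single_apply]
      rw [this, map_sum]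
      refine Subalgebra.sum_mem _ fun i _ => ?_
      rw [map_smul]
      exact Subalgebra.smul_mem _ (Algebra.subset_adjoin (Set.mem_range_self i)) _
  obtain ⟨h1, h2⟩ := hfin
  have h3 : Module.Finite ℝ A := Module.Finite.of_surjective F.toLinearMap hsurj
  have h4 : finrank ℝ (Cl Q) = finrank ℝ A := by
    refine le_antisymm (he.finrank_eq ▸ h2) (F.toLinearMap.finrank_le_finrank_of_surjective hsurj)
  have hinj : Function.Injective F :=
    (LinearMap.injective_iff_surjective_of_finrank_eq_finrank (f := F.toLinearMap) h4).2 hsurj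
  exact ⟨h1, ⟨StarAlgEquiv.ofAlgEquiv (AlgEquiv.ofBijective F ⟨hinj, hsurj⟩) hFstar⟩⟩

/-! ### Tensor products with the quaternions -/

/-- The quaternion with given components. -/
def quaternionOf (r x y z : ℝ) : ℍ[ℝ] := ⟨r, x, y, z⟩

namespace quaternionOf

variable (r x y z : ℝ)

@[simp] theorem re_eq : (quaternionOf r x y z).re = r := rfl
@[simp] theorem imI_eq : (quaternionOf r x y z).imI = x := rfl
@[simp] theorem imJ_eq : (quaternionOf r x y z).imJ = y := rfl
@[simp] theorem imK_eq : (quaternionOf r x y z).imK = z := rfl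

end quaternionOf

/-- The star algebra `B` is the tensor product of the quaternions and `A`, expressed by commuting
homomorphisms from the factors with jointly generating ranges and by the dimension. -/
structure QuaternionExtension {A B : Type*} [Ring A] [StarRing A] [Algebra ℝ A]
    [Ring B] [StarRing B] [Algebra ℝ B] (a : ℍ[ℝ] →⋆ₐ[ℝ] B) (b : A →⋆ₐ[ℝ] B) : Prop where
  commute : ∀ q x, a q * b x = b x * a q
  generates : ∀ S : Subalgebra ℝ B, (∀ q, a q ∈ S) → (∀ x, b x ∈ S) → S = ⊤
  finrank_eq : finrank ℝ B = 4 * finrank ℝ A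

namespace Subalgebra

variable {B ι : Type*} [Ring B] [Algebra ℝ B] [Fintype ι] [DecidableEq ι]

/-- A matrix is the sum of its entries, taken as scalar matrices, times matrix units. -/
theorem matrix_eq_top {S : Subalgebra ℝ (Matrix ι ι B)}
    (hscalar : S.comap (Matrix.scalarAlgHom ι ℝ) = ⊤)
    (hsingle : ∀ i j, Matrix.single i j 1 ∈ S) : S = ⊤ := by
  refine eq_top_iff.2 fun M _ => ?_
  rw [Matrix.matrix_eq_sum_single M]
  refine S.sum_mem fun i _ => S.sum_mem fun j _ => ?_
  have h : Matrix.scalarAlgHom ι ℝ (M i j) ∈ S := by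
    have : M i j ∈ S.comap (Matrix.scalarAlgHom ι ℝ) := hscalar ▸ Algebra.mem_top
    exact this
  have h2 := S.mul_mem h (hsingle i j)
  convert h2 using 1
  ext k l
  simp [Matrix.diagonal_mul, Matrix.single_apply]

end Subalgebra

/-- Scalar matrices as a star algebra homomorphism. -/
def Matrix.scalarStarAlgHom (ι B : Type*) [Ring B] [StarRing B] [Algebra ℝ B] [Fintype ι]
    [DecidableEq ι] : B →⋆ₐ[ℝ] Matrix ι ι B :=
  { Matrix.scalarAlgHom ι ℝ with
    map_star' := fun x => by
      change Matrix.scalar ι (star x) = star (Matrix.scalar ι x)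
      rw [Matrix.scalar_apply, Matrix.scalar_apply, Matrix.star_eq_conjTranspose,
        Matrix.diagonal_conjTranspose]
      rfl }

/-- Entrywise application of a star algebra homomorphism. -/
def StarAlgHom.mapMatrix {A B : Type*} [Ring A] [StarRing A] [Algebra ℝ A]
    [Ring B] [StarRing B] [Algebra ℝ B] (ι : Type*) [Fintype ι] [DecidableEq ι]
    (f : A →⋆ₐ[ℝ] B) : Matrix ι ι A →⋆ₐ[ℝ] Matrix ι ι B :=
  { f.toAlgHom.mapMatrix with
    map_star' := fun M => by
      ext i j
      exact map_star f (M j i) }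

namespace QuaternionExtension

variable {A B : Type*} [Ring A] [StarRing A] [Algebra ℝ A] [Ring B] [StarRing B] [Algebra ℝ B]
  {a : ℍ[ℝ] →⋆ₐ[ℝ] B} {b : A →⋆ₐ[ℝ] B}

/-- This is ℍ ⊗ M_ι(A) = M_ι(ℍ ⊗ A). -/
theorem matrix (h : QuaternionExtension a b) [Module.Finite ℝ A] [Module.Finite ℝ B]
    (ι : Type*) [Fintype ι] [DecidableEq ι] :
    QuaternionExtension ((Matrix.scalarStarAlgHom ι B).comp a) (b.mapMatrix ι) where
  commute q M := by
    change Matrix.scalar ι (a q) * M.map b = M.map b * Matrix.scalar ι (a q)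
    ext i j
    simp [h.commute]
  generates S hq hx := by
    refine Subalgebra.matrix_eq_top (h.generates _ hq fun x => ?_) fun i j => ?_
    · have := hx (Matrix.scalar ι x)
      rw [Subalgebra.mem_comap]
      convert this using 1
      change Matrix.scalar ι (b x) = (Matrix.scalar ι x).map b
      simp [Matrix.diagonal_map]
    · convert hx (Matrix.single i j 1) using 1
      change _ = (Matrix.single i j 1).map b
      simp [Matrix.map_single]
  finrank_eq := by
    rw [finrank_matrix, finrank_matrix, h.finrank_eq]
    ring

theorem prod {A' B' : Type*} [Ring A'] [StarRing A'] [Algebra ℝ A']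
    [Ring B'] [StarRing B'] [Algebra ℝ B'] {a' : ℍ[ℝ] →⋆ₐ[ℝ] B'} {b' : A' →⋆ₐ[ℝ] B'}
    (h : QuaternionExtension a b) (h' : QuaternionExtension a' b')
    [Module.Finite ℝ A] [Module.Finite ℝ B] [Module.Finite ℝ A'] [Module.Finite ℝ B'] :
    QuaternionExtension (a.prod a')
      ((b.comp (StarAlgHom.fst ℝ A A')).prod (b'.comp (StarAlgHom.snd ℝ A A'))) where
  commute q x := Prod.ext (h.commute q x.1) (h'.commute q x.2)
  generates S hq hx := by
    -- The central idempotents come from A × A', so `S` splits into its two factors.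
    have h10 : ((1, 0) : B × B') ∈ S := by simpa using hx (1, 0)
    have h01 : ((0, 1) : B × B') ∈ S := by simpa using hx (0, 1)
    let S₁ : Subalgebra ℝ B :=
      { carrier := {y | (y, 0) ∈ S}
        mul_mem' := fun {y z} hy hz => by simpa using S.mul_mem hy hz
        add_mem' := fun {y z} hy hz => by simpa using S.add_mem hy hz
        algebraMap_mem' := fun r => by
          simpa [Algebra.algebraMap_eq_smul_one] using S.smul_mem h10 r }
    let S₂ : Subalgebra ℝ B' :=
      { carrier := {y | (0, y) ∈ S}
        mul_mem' := fun {y z} hy hz => by simpa using S.mul_mem hy hz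
        add_mem' := fun {y z} hy hz => by simpa using S.add_mem hy hz
        algebraMap_mem' := fun r => by
          simpa [Algebra.algebraMap_eq_smul_one] using S.smul_mem h01 r }
    have e₁ : S₁ = ⊤ := h.generates S₁
      (fun q => show (a q, 0) ∈ S by simpa using S.mul_mem h10 (hq q))
      (fun x => show (b x, 0) ∈ S by simpa using hx (x, 0))
    have e₂ : S₂ = ⊤ := h'.generates S₂
      (fun q => show (0, a' q) ∈ S by simpa using S.mul_mem h01 (hq q))
      (fun x => show (0, b' x) ∈ S by simpa using hx (0, x))
    refine eq_top_iff.2 fun y _ => ?_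
    have h1 : (y.1, 0) ∈ S := show y.1 ∈ S₁ from e₁ ▸ Algebra.mem_top
    have h2 : (0, y.2) ∈ S := show y.2 ∈ S₂ from e₂ ▸ Algebra.mem_top
    simpa using S.add_mem h1 h2
  finrank_eq := by
    rw [finrank_prod, finrank_prod, h.finrank_eq, h'.finrank_eq]
    ring

end QuaternionExtension

/-! ### The step from n to n + 4 -/

/-- The images of `i`, `j`, `k` on the diagonal with alternating sign, a rotation, and the images
of a given system off the diagonal. -/
noncomputable def quaternionicExtensionSystem {A B ι : Type*} [Ring A] [StarRing A] [Algebra ℝ A]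
    [Ring B] [StarRing B] [Algebra ℝ B] (a : ℍ[ℝ] →⋆ₐ[ℝ] B) (b : A →⋆ₐ[ℝ] B) (e : ι → A) :
    ι ⊕ Fin 4 → Matrix (Fin 2) (Fin 2) B :=
  Sum.elim (fun i => !![0, b (e i); b (e i), 0])
    ![!![a (quaternionOf 0 1 0 0), 0; 0, -a (quaternionOf 0 1 0 0)], !![a (quaternionOf 0 0 1 0), 0; 0, -a (quaternionOf 0 0 1 0)],
      !![a (quaternionOf 0 0 0 1), 0; 0, -a (quaternionOf 0 0 0 1)], !![0, 1; -1, 0]]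

/-- A diagonal matrix diag(q, -q) anticommutes with an off-diagonal one built from x because q and x
commute in `B`; the sign comes from the 2 × 2 pattern. Dimensions agree: 4 (block entries) · 4
(quaternions) = 2^4. -/
theorem CliffordSystem.quaternionicExtension {A B ι : Type*} [Fintype ι] [Ring A] [StarRing A]
    [Algebra ℝ A] [Ring B] [StarRing B] [Algebra ℝ B]
    [Module.Finite ℝ A] [Module.Finite ℝ B] {a : ℍ[ℝ] →⋆ₐ[ℝ] B} {b : A →⋆ₐ[ℝ] B} {e : ι → A}
    (he : CliffordSystem e) (h : QuaternionExtension a b) :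
    CliffordSystem (quaternionicExtensionSystem a b e) := by
  obtain ⟨I, hI⟩ : ∃ I : ℍ[ℝ], I = quaternionOf 0 1 0 0 := ⟨_, rfl⟩
  obtain ⟨J, hJ⟩ : ∃ J : ℍ[ℝ], J = quaternionOf 0 0 1 0 := ⟨_, rfl⟩
  obtain ⟨K, hK⟩ : ∃ K : ℍ[ℝ], K = quaternionOf 0 0 0 1 := ⟨_, rfl⟩
  have hdef : quaternionicExtensionSystem a b e = Sum.elim (fun i => !![0, b (e i); b (e i), 0])
      ![!![a I, 0; 0, -a I], !![a J, 0; 0, -a J], !![a K, 0; 0, -a K], !![0, 1; -1, 0]] := by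
    rw [hI, hJ, hK]; rfl
  have II : a I * a I = -1 := by
    rw [← map_mul, ← map_one a, ← map_neg a, hI]; congr 1; ext <;> simp
  have JJ : a J * a J = -1 := by
    rw [← map_mul, ← map_one a, ← map_neg a, hJ]; congr 1; ext <;> simp
  have KK : a K * a K = -1 := by
    rw [← map_mul, ← map_one a, ← map_neg a, hK]; congr 1; ext <;> simp
  have IJ : a I * a J = a K := by
    rw [← map_mul, hI, hJ, hK]; congr 1; ext <;> simp
  have JI : a J * a I = -a K := by
    rw [← map_mul, ← map_neg, hI, hJ, hK]; congr 1; ext <;> simp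
  have JK : a J * a K = a I := by
    rw [← map_mul, hI, hJ, hK]; congr 1; ext <;> simp
  have KJ : a K * a J = -a I := by
    rw [← map_mul, ← map_neg, hI, hJ, hK]; congr 1; ext <;> simp
  have KI : a K * a I = a J := by
    rw [← map_mul, hI, hJ, hK]; congr 1; ext <;> simp
  have IK : a I * a K = -a J := by
    rw [← map_mul, ← map_neg, hI, hJ, hK]; congr 1; ext <;> simp
  have sI : star (a I) = -a I := by
    rw [← map_star, ← map_neg, hI]; congr 1; ext <;> simp
  have sJ : star (a J) = -a J := by
    rw [← map_star, ← map_neg, hJ]; congr 1; ext <;> simp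
  have sK : star (a K) = -a K := by
    rw [← map_star, ← map_neg, hK]; congr 1; ext <;> simp
  have be : ∀ i, b (e i) * b (e i) = -1 := fun i => by rw [← map_mul, he.sq, map_neg, map_one]
  have bee : ∀ i j, i ≠ j → b (e i) * b (e j) = -(b (e j) * b (e i)) := fun i j hij => by
    rw [← map_mul, he.anticomm i j hij, map_neg, map_mul]
  have sb : ∀ i, star (b (e i)) = -b (e i) := fun i => by rw [← map_star, he.star_eq, map_neg]
  rw [hdef]
  refine ⟨?_, ?_, ?_, ?_, ?_⟩
  · rintro (i | i)
    · simp [be, Matrix.one_fin_two]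
    · fin_cases i <;> simp [II, JJ, KK, Matrix.one_fin_two]
  · rintro (i | i) (j | j) hij
    · have hij' : i ≠ j := fun h => hij (congrArg _ h)
      simp [bee i j hij']
    · fin_cases j <;> simp [h.commute]
    · fin_cases i <;> simp [h.commute]
    · have hij' : i ≠ j := fun h => hij (congrArg _ h)
      fin_cases i <;> fin_cases j <;> first | exact absurd rfl hij' | simp [IJ, JI, JK, KJ, IK, KI]
  · have star_fin_two : ∀ x y z w : B,
        star !![x, y; z, w] = !![star x, star z; star y, star w] := fun x y z w => by
      ext i j
      fin_cases i <;> fin_cases j <;> rfl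
    rintro (i | i)
    · simp [star_fin_two, sb]
    · fin_cases i <;> simp [star_fin_two, sI, sJ, sK]
  · intro S hS
    have hb : ∀ i, !![0, b (e i); b (e i), 0] ∈ S := fun i => hS (Sum.inl i)
    have m0 : !![a I, 0; 0, -a I] ∈ S := hS (Sum.inr 0)
    have m1 : !![a J, 0; 0, -a J] ∈ S := hS (Sum.inr 1)
    have m2 : !![a K, 0; 0, -a K] ∈ S := hS (Sum.inr 2)
    have m3 : !![0, 1; -1, 0] ∈ S := hS (Sum.inr 3)
    -- Since ijk = -1, the product of the three diagonal generators is diag(-1, 1). With the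
    -- rotation this yields all matrix units.
    have d : !![1, 0; 0, (-1 : B)] ∈ S := by
      convert S.neg_mem (S.mul_mem (S.mul_mem m0 m1) m2) using 1
      simp [IJ, KK]
    have E₀₀ : Matrix.single 0 0 (1 : B) ∈ S := by
      convert S.smul_mem (S.add_mem S.one_mem d) (1 / 2 : ℝ) using 1
      ext i j
      fin_cases i <;> fin_cases j <;> simp [Matrix.one_fin_two, ← two_smul ℝ (1 : B)]
    have E₁₁ : Matrix.single 1 1 (1 : B) ∈ S := by
      convert S.sub_mem S.one_mem E₀₀ using 1
      ext i j
      fin_cases i <;> fin_cases j <;> simp [Matrix.one_fin_two]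
    have E₀₁ : Matrix.single 0 1 (1 : B) ∈ S := by
      convert S.mul_mem E₀₀ m3 using 1
      ext i j
      fin_cases i <;> fin_cases j <;> simp [Matrix.mul_apply, Matrix.single]
    have E₁₀ : Matrix.single 1 0 (1 : B) ∈ S := by
      convert S.neg_mem (S.mul_mem E₁₁ m3) using 1
      ext i j
      fin_cases i <;> fin_cases j <;> simp [Matrix.mul_apply, Matrix.single]
    have diag_mem : ∀ x : B, !![x, 0; 0, x] ∈ S → x ∈ S.comap (Matrix.scalarAlgHom (Fin 2) ℝ) := by
      intro x hx
      rw [Subalgebra.mem_comap]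
      convert hx using 1
      ext i j
      fin_cases i <;> fin_cases j <;> simp
    have cI : a I ∈ S.comap (Matrix.scalarAlgHom (Fin 2) ℝ) := diag_mem _ (by
      simpa using S.mul_mem d m0)
    have cJ : a J ∈ S.comap (Matrix.scalarAlgHom (Fin 2) ℝ) := diag_mem _ (by
      simpa using S.mul_mem d m1)
    have cK : a K ∈ S.comap (Matrix.scalarAlgHom (Fin 2) ℝ) := diag_mem _ (by
      simpa using S.mul_mem d m2)
    -- `d` times the rotation is the swap matrix, which moves the off-diagonal entries to the
    -- diagonal.
    have cb : ∀ i, b (e i) ∈ S.comap (Matrix.scalarAlgHom (Fin 2) ℝ) := fun i => diag_mem _ (by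
      simpa using S.mul_mem (S.mul_mem d m3) (hb i))
    refine Subalgebra.matrix_eq_top (h.generates _ (fun q => ?_) fun x => ?_) fun i j => ?_
    · have hq : q = q.re • (1 : ℍ[ℝ]) + q.imI • I + q.imJ • J + q.imK • K := by
        rw [hI, hJ, hK]; ext <;> simp
      rw [hq]
      simp only [map_add, map_smul, map_one]
      exact add_mem (add_mem (add_mem (Subalgebra.smul_mem _ (one_mem _) _)
        (Subalgebra.smul_mem _ cI _)) (Subalgebra.smul_mem _ cJ _)) (Subalgebra.smul_mem _ cK _)
    · have := he.generates ((S.comap (Matrix.scalarAlgHom (Fin 2) ℝ)).comap b.toAlgHom) cb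
      have hx : x ∈ (S.comap (Matrix.scalarAlgHom (Fin 2) ℝ)).comap b.toAlgHom :=
        this ▸ Algebra.mem_top
      exact hx
    · fin_cases i <;> fin_cases j <;> assumption
  · rw [finrank_matrix, h.finrank_eq, he.finrank_eq]
    simp [pow_add]
    ring

/-! ### The tensor products of ℍ with ℝ, ℂ and ℍ -/

instance Quaternion.instStarModuleReal : StarModule ℝ ℍ[ℝ] := ⟨fun r q => by ext <;> simp⟩

/-- The standard representation of the quaternions by complex `2 × 2` matrices. -/
noncomputable def quaternionToComplexMatrix : ℍ[ℝ] →⋆ₐ[ℝ] Matrix (Fin 2) (Fin 2) ℂ where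
  toFun q := !![⟨q.re, q.imI⟩, ⟨q.imJ, q.imK⟩; ⟨-q.imJ, q.imK⟩, ⟨q.re, -q.imI⟩]
  map_one' := by
    ext i j
    fin_cases i <;> fin_cases j <;> simp [Complex.ext_iff]
  map_mul' p q := by
    ext i j
    fin_cases i <;> fin_cases j <;> simp [Complex.ext_iff] <;> constructor <;> ring
  map_zero' := by
    ext i j
    fin_cases i <;> fin_cases j <;> simp [Complex.ext_iff]
  map_add' p q := by
    ext i j
    fin_cases i <;> fin_cases j <;> simp [Complex.ext_iff] <;> ring
  commutes' r := by
    ext i j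
    fin_cases i <;> fin_cases j <;>
      simp [Complex.ext_iff, Matrix.algebraMap_matrix_apply, Quaternion.algebraMap_def]
  map_star' q := by
    ext i j
    fin_cases i <;> fin_cases j <;> simp [Complex.ext_iff, Matrix.star_apply]

/-- The matrix of the left multiplication by a quaternion. -/
noncomputable def quaternionLeftMatrix : ℍ[ℝ] →⋆ₐ[ℝ] Matrix (Fin 4) (Fin 4) ℝ where
  toFun q := !![q.re, -q.imI, -q.imJ, -q.imK; q.imI, q.re, -q.imK, q.imJ;
    q.imJ, q.imK, q.re, -q.imI; q.imK, -q.imJ, q.imI, q.re]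
  map_one' := by
    ext i j
    fin_cases i <;> fin_cases j <;> simp
  map_mul' p q := by
    ext i j
    fin_cases i <;> fin_cases j <;> simp [Matrix.mul_apply, Fin.sum_univ_four] <;> ring
  map_zero' := by
    ext i j
    fin_cases i <;> fin_cases j <;> simp
  map_add' p q := by
    ext i j
    fin_cases i <;> fin_cases j <;> simp <;> ring
  commutes' r := by
    ext i j
    fin_cases i <;> fin_cases j <;>
      simp [Matrix.algebraMap_matrix_apply, Quaternion.algebraMap_def]
  map_star' q := by
    ext i j
    fin_cases i <;> fin_cases j <;> simp [Matrix.star_apply]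

theorem quaternionLeftMatrix_apply (q : ℍ[ℝ]) : quaternionLeftMatrix q =
    !![q.re, -q.imI, -q.imJ, -q.imK; q.imI, q.re, -q.imK, q.imJ;
      q.imJ, q.imK, q.re, -q.imI; q.imK, -q.imJ, q.imI, q.re] := rfl

/-- The matrix of the right multiplication by the conjugate of a quaternion. -/
noncomputable def quaternionRightMatrix : ℍ[ℝ] →⋆ₐ[ℝ] Matrix (Fin 4) (Fin 4) ℝ where
  toFun q := !![q.re, q.imI, q.imJ, q.imK; -q.imI, q.re, -q.imK, q.imJ;
    -q.imJ, q.imK, q.re, -q.imI; -q.imK, -q.imJ, q.imI, q.re]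
  map_one' := by
    ext i j
    fin_cases i <;> fin_cases j <;> simp
  map_mul' p q := by
    ext i j
    fin_cases i <;> fin_cases j <;> simp [Matrix.mul_apply, Fin.sum_univ_four] <;> ring
  map_zero' := by
    ext i j
    fin_cases i <;> fin_cases j <;> simp
  map_add' p q := by
    ext i j
    fin_cases i <;> fin_cases j <;> simp <;> ring
  commutes' r := by
    ext i j
    fin_cases i <;> fin_cases j <;>
      simp [Matrix.algebraMap_matrix_apply, Quaternion.algebraMap_def]
  map_star' q := by
    ext i j
    fin_cases i <;> fin_cases j <;> simp [Matrix.star_apply]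

theorem quaternionRightMatrix_apply (q : ℍ[ℝ]) : quaternionRightMatrix q =
    !![q.re, q.imI, q.imJ, q.imK; -q.imI, q.re, -q.imK, q.imJ;
      -q.imJ, q.imK, q.re, -q.imI; -q.imK, -q.imJ, q.imI, q.re] := rfl

namespace QuaternionExtension

theorem real : QuaternionExtension (StarAlgHom.id ℝ ℍ[ℝ]) (StarAlgHom.ofId ℝ ℍ[ℝ]) where
  commute q x := (Algebra.commutes x q).symm
  generates S hq _ := eq_top_iff.2 fun q _ => hq q
  finrank_eq := by rw [Quaternion.finrank_eq_four, finrank_self]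

theorem complex :
    QuaternionExtension quaternionToComplexMatrix (Matrix.scalarStarAlgHom (Fin 2) ℂ) where
  commute q x := (Matrix.scalar_commute x (fun y => mul_comm x y) _).symm
  generates S hq hx := by
    have hi : !![⟨0, 1⟩, 0; 0, ⟨0, -1⟩] ∈ S := by
      convert hq (quaternionOf 0 1 0 0) using 1
      simp [quaternionToComplexMatrix, Complex.ext_iff]
    have hj : !![0, 1; -1, 0] ∈ S := by
      convert hq (quaternionOf 0 0 1 0) using 1
      simp [quaternionToComplexMatrix, Complex.ext_iff]
    -- The scalar i times diag(i, -i) is diag(-1, 1); half of 1 minus this is the first matrix unit.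
    have E₀₀ : Matrix.single 0 0 (1 : ℂ) ∈ S := by
      convert S.smul_mem (S.sub_mem S.one_mem (S.mul_mem (hx Complex.I) hi)) (1 / 2 : ℝ) using 1
      change _ = _ • (1 - Matrix.scalar (Fin 2) Complex.I * _)
      ext i j
      fin_cases i <;> fin_cases j <;> (simp [Complex.ext_iff]; try norm_num)
    have E₁₁ : Matrix.single 1 1 (1 : ℂ) ∈ S := by
      convert S.sub_mem S.one_mem E₀₀ using 1
      ext i j
      fin_cases i <;> fin_cases j <;> simp [Matrix.one_fin_two]
    have E₀₁ : Matrix.single 0 1 (1 : ℂ) ∈ S := by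
      convert S.mul_mem E₀₀ hj using 1
      ext i j
      fin_cases i <;> fin_cases j <;> simp [Matrix.mul_apply, Matrix.single]
    have E₁₀ : Matrix.single 1 0 (1 : ℂ) ∈ S := by
      convert S.neg_mem (S.mul_mem E₁₁ hj) using 1
      ext i j
      fin_cases i <;> fin_cases j <;> simp [Matrix.mul_apply, Matrix.single]
    refine Subalgebra.matrix_eq_top (eq_top_iff.2 fun x _ => hx x) fun i j => ?_
    fin_cases i <;> fin_cases j <;> assumption
  finrank_eq := by
    rw [finrank_matrix]
    simp

theorem commute_quaternionLeftMatrix_quaternionRightMatrix (p q : ℍ[ℝ]) :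
    quaternionLeftMatrix p * quaternionRightMatrix q =
      quaternionRightMatrix q * quaternionLeftMatrix p := by
  rw [quaternionLeftMatrix_apply, quaternionRightMatrix_apply]
  ext i j
  fin_cases i <;> fin_cases j <;> simp [Matrix.mul_apply, Fin.sum_univ_four] <;> ring

/-- The standard basis of the quaternions. -/
def quaternionUnit : Fin 4 → ℍ[ℝ] :=
  ![quaternionOf 1 0 0 0, quaternionOf 0 1 0 0, quaternionOf 0 0 1 0, quaternionOf 0 0 0 1]

theorem quaternionLeftMatrix_unit_apply_zero (i k : Fin 4) :
    quaternionLeftMatrix (quaternionUnit i) k 0 = if i = k then 1 else 0 := by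
  rw [quaternionLeftMatrix_apply]
  fin_cases i <;> fin_cases k <;> simp [quaternionUnit]

theorem quaternionLeftMatrix_star_unit_zero_apply (i k : Fin 4) :
    quaternionLeftMatrix (star (quaternionUnit i)) 0 k = if i = k then 1 else 0 := by
  rw [map_star, Matrix.star_apply, quaternionLeftMatrix_unit_apply_zero, star_trivial]

/-- Averaging u x ū over u = 1, i, j, k projects x to its real part. -/
theorem single_zero_zero_eq_sum_quaternionMatrix :
    Matrix.single 0 0 (1 : ℝ) = (1 / 4 : ℝ) • ∑ i,
      quaternionLeftMatrix (quaternionUnit i) * quaternionRightMatrix (quaternionUnit i) := by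
  simp only [Fin.sum_univ_four, quaternionLeftMatrix_apply, quaternionRightMatrix_apply,
    quaternionUnit]
  ext i j
  fin_cases i <;> fin_cases j <;> (simp; try norm_num)

/-- The projection to the real part is a matrix unit. Left multiplication by the i-th basis
quaternion carries it to column unit (i, 0), the conjugate on the other side gives row unit (0, i),
and products of these give all units. -/
theorem quaternion : QuaternionExtension quaternionLeftMatrix quaternionRightMatrix where
  commute := commute_quaternionLeftMatrix_quaternionRightMatrix
  generates S hl hr := by
    have E₀₀ : Matrix.single 0 0 (1 : ℝ) ∈ S := by
      rw [single_zero_zero_eq_sum_quaternionMatrix]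
      exact S.smul_mem (S.sum_mem fun i _ => S.mul_mem (hl _) (hr _)) _
    have hcol : ∀ i, Matrix.single i 0 (1 : ℝ) ∈ S := fun i => by
      convert S.mul_mem (hl (quaternionUnit i)) E₀₀ using 1
      ext k l
      by_cases hl : 0 = l
      · subst hl
        simp [Matrix.single_apply, Matrix.mul_apply, quaternionLeftMatrix_unit_apply_zero]
      · simp [Matrix.mul_apply, hl]
    have hrow : ∀ i, Matrix.single 0 i (1 : ℝ) ∈ S := fun i => by
      convert S.mul_mem E₀₀ (hl (star (quaternionUnit i))) using 1
      ext k l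
      by_cases hk : 0 = k
      · subst hk
        simp [Matrix.single_apply, Matrix.mul_apply, quaternionLeftMatrix_star_unit_zero_apply]
      · simp [Matrix.mul_apply, hk]
    refine Subalgebra.matrix_eq_top (eq_top_iff.2 fun x _ => ?_) fun i j => ?_
    · exact (S.comap (Matrix.scalarAlgHom (Fin 4) ℝ)).algebraMap_mem x
    · convert S.mul_mem (hcol i) (hrow j) using 1
      simp
  finrank_eq := by
    rw [finrank_matrix, Quaternion.finrank_eq_four]
    simp

end QuaternionExtension

/-! ### Trace forms and compactness of unitary groups -/

/-- A linear functional `τ` on a real star algebra for which `τ (star x * x)` is the sum of the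
squares of linear coordinates of `x`. -/
def HasFrobeniusForm (A : Type*) [Ring A] [StarRing A] [Algebra ℝ A] : Prop :=
  ∃ (ι : Type) (_ : Fintype ι) (L : A →ₗ[ℝ] (ι → ℝ)) (τ : A →ₗ[ℝ] ℝ),
    Function.Injective L ∧ ∀ x, τ (star x * x) = ∑ i, L x i ^ 2

namespace HasFrobeniusForm

theorem real : HasFrobeniusForm ℝ :=
  ⟨Unit, inferInstance, LinearMap.pi fun _ => LinearMap.id, LinearMap.id,
    fun x y h => congrFun h (), fun x => by simp [sq]⟩

theorem complex : HasFrobeniusForm ℂ :=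
  ⟨Fin 2, inferInstance, Complex.basisOneI.equivFun.toLinearMap, Complex.reLm,
    Complex.basisOneI.equivFun.injective, fun x => by simp [sq, Fin.sum_univ_two]⟩

theorem quaternion : HasFrobeniusForm ℍ[ℝ] := by
  let re : ℍ[ℝ] →ₗ[ℝ] ℝ := { toFun := fun q => q.re, map_add' := by simp, map_smul' := by simp }
  let i : ℍ[ℝ] →ₗ[ℝ] ℝ := { toFun := fun q => q.imI, map_add' := by simp, map_smul' := by simp }
  let j : ℍ[ℝ] →ₗ[ℝ] ℝ := { toFun := fun q => q.imJ, map_add' := by simp, map_smul' := by simp }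
  let k : ℍ[ℝ] →ₗ[ℝ] ℝ := { toFun := fun q => q.imK, map_add' := by simp, map_smul' := by simp }
  refine ⟨Fin 4, inferInstance, LinearMap.pi ![re, i, j, k], re, fun x y h => ?_, fun x => ?_⟩
  · exact Quaternion.ext _ _ (congrFun h 0) (congrFun h 1) (congrFun h 2) (congrFun h 3)
  · simp only [Fin.sum_univ_four, LinearMap.pi_apply]
    change (star x * x).re = x.re ^ 2 + x.imI ^ 2 + x.imJ ^ 2 + x.imK ^ 2
    simp
    ring

variable {A B : Type*} [Ring A] [StarRing A] [Algebra ℝ A] [Ring B] [StarRing B] [Algebra ℝ B]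

theorem matrix (h : HasFrobeniusForm A) (n : ℕ) :
    HasFrobeniusForm (Matrix (Fin n) (Fin n) A) := by
  obtain ⟨ι, _, L, τ, hL, hτ⟩ := h
  refine ⟨Fin n × Fin n × ι, inferInstance,
    LinearMap.pi fun p => LinearMap.proj p.2.2 ∘ₗ L ∘ₗ Matrix.entryLinearMap ℝ A p.1 p.2.1,
    τ ∘ₗ Matrix.traceLinearMap (Fin n) ℝ A, fun x y hxy => ?_, fun x => ?_⟩
  · ext i j
    exact hL (funext fun k => congrFun hxy (i, j, k))
  · simp only [LinearMap.comp_apply, Matrix.traceLinearMap_apply, Matrix.trace, Matrix.diag_apply,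
      Matrix.mul_apply, Matrix.star_apply, map_sum, hτ, LinearMap.pi_apply,
      LinearMap.proj_apply, Matrix.entryLinearMap_apply, Fintype.sum_prod_type]
    exact Finset.sum_comm

theorem prod (hA : HasFrobeniusForm A) (hB : HasFrobeniusForm B) : HasFrobeniusForm (A × B) := by
  obtain ⟨ι, _, L, τ, hL, hτ⟩ := hA
  obtain ⟨κ, _, M, σ, hM, hσ⟩ := hB
  refine ⟨ι ⊕ κ, inferInstance,
    LinearMap.pi (Sum.elim (fun i => LinearMap.proj i ∘ₗ L ∘ₗ LinearMap.fst ℝ A B)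
      (fun i => LinearMap.proj i ∘ₗ M ∘ₗ LinearMap.snd ℝ A B)),
    τ.coprod σ, fun x y hxy => ?_, fun x => ?_⟩
  · exact Prod.ext (hL (funext fun i => congrFun hxy (Sum.inl i)))
      (hM (funext fun i => congrFun hxy (Sum.inr i)))
  · simp [hτ, hσ]

theorem of_starAlgEquiv (h : HasFrobeniusForm B) (φ : A ≃⋆ₐ[ℝ] B) : HasFrobeniusForm A := by
  obtain ⟨ι, _, L, τ, hL, hτ⟩ := h
  refine ⟨ι, inferInstance, L ∘ₗ φ.toAlgEquiv.toLinearMap, τ ∘ₗ φ.toAlgEquiv.toLinearMap,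
    hL.comp φ.injective, fun x => ?_⟩
  change τ (φ (star x * x)) = ∑ i, L (φ x) i ^ 2
  rw [map_mul, map_star, hτ]

/-- The unitary group of a finite dimensional real star algebra with a Frobenius form is
compact. -/
theorem isCompact_unitary [TopologicalSpace A] [IsModuleTopology ℝ A] [Module.Finite ℝ A]
    [StarModule ℝ A] (h : HasFrobeniusForm A) : IsCompact (unitary A : Set A) := by
  obtain ⟨ι, _, L, τ, hL, hτ⟩ := h
  have hLc : Continuous L := IsModuleTopology.continuous_of_linearMap L
  have : IsTopologicalAddGroup A := IsModuleTopology.topologicalAddGroup ℝ A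
  have : IsTopologicalRing A := IsModuleTopology.isTopologicalRing ℝ A
  have : T2Space A := T2Space.of_injective_continuous hL hLc
  have hstar : Continuous (star : A → A) :=
    IsModuleTopology.continuous_of_linearMap (starLinearEquiv ℝ (A := A)).toLinearMap
  have hclosed : IsClosed (unitary A : Set A) := by
    have : (unitary A : Set A) = {x | star x * x = 1} ∩ {x | x * star x = 1} := by
      ext x; exact Unitary.mem_iff
    rw [this]
    exact (isClosed_eq (hstar.mul continuous_id) continuous_const).inter
      (isClosed_eq (continuous_id.mul hstar) continuous_const)
  have hemb : Topology.IsClosedEmbedding L :=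
    LinearMap.isClosedEmbedding_of_injective (LinearMap.ker_eq_bot.2 hL)
  -- Unitary elements have coordinates with t² ≤ τ(1); the cruder bound |t| ≤ 1 + τ(1) avoids a
  -- square root and follows from 2|t| ≤ 1 + t².
  have hK : IsCompact (Set.univ.pi fun _ : ι => Set.Icc (-(1 + τ 1)) (1 + τ 1)) :=
    isCompact_univ_pi fun _ => isCompact_Icc
  refine (hemb.isCompact_preimage hK).of_isClosed_subset hclosed fun x hx i _ => ?_
  have h1 : ∑ i, L x i ^ 2 = τ 1 := by rw [← hτ, (Unitary.mem_iff.1 hx).1]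
  have h2 : L x i ^ 2 ≤ τ 1 :=
    h1 ▸ Finset.single_le_sum (f := fun i => L x i ^ 2) (fun _ _ => sq_nonneg _)
      (Finset.mem_univ i)
  constructor <;> nlinarith [sq_nonneg (L x i - 1), sq_nonneg (L x i + 1)]

end HasFrobeniusForm

/-! ### Star isomorphisms of matrix algebras and their unitary groups -/

namespace Matrix

variable (ι κ A B : Type*) [Fintype ι] [DecidableEq ι] [Fintype κ] [DecidableEq κ]
  [Ring A] [StarRing A] [Algebra ℝ A] [Ring B] [StarRing B] [Algebra ℝ B]

/-- Block matrices are matrices. -/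
def compStarAlgEquiv : Matrix ι ι (Matrix κ κ A) ≃⋆ₐ[ℝ] Matrix (ι × κ) (ι × κ) A :=
  StarAlgEquiv.ofAlgEquiv (compAlgEquiv ι κ A ℝ) fun _ => rfl

variable {ι κ} in
/-- Reindexing of matrices. -/
def reindexStarAlgEquiv (e : ι ≃ κ) : Matrix ι ι A ≃⋆ₐ[ℝ] Matrix κ κ A :=
  StarAlgEquiv.ofAlgEquiv (reindexAlgEquiv ℝ A e) fun _ => rfl

/-- Matrices of size one are scalars. -/
def finOneStarAlgEquiv : Matrix (Fin 1) (Fin 1) A ≃⋆ₐ[ℝ] A where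
  toFun M := M 0 0
  invFun x := of fun _ _ => x
  left_inv M := by
    ext i j
    rw [Subsingleton.elim i 0, Subsingleton.elim j 0]
    rfl
  right_inv x := rfl
  map_mul' M N := by simp [mul_apply]
  map_add' M N := rfl
  map_star' M := rfl
  map_smul' r M := rfl

/-- Matrices over a product are pairs of matrices. -/
def prodStarAlgEquiv : Matrix ι ι (A × B) ≃⋆ₐ[ℝ] Matrix ι ι A × Matrix ι ι B where
  toFun M := (M.map Prod.fst, M.map Prod.snd)
  invFun M := of fun i j => (M.1 i j, M.2 i j)
  left_inv M := rfl
  right_inv M := rfl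
  map_mul' M N := by
    ext i j <;> simp [mul_apply, Prod.fst_sum, Prod.snd_sum]
  map_add' M N := rfl
  map_star' M := rfl
  map_smul' r M := rfl

theorem nonempty_finStarAlgEquiv {m n N : ℕ} (h : m * n = N) :
    Nonempty (Matrix (Fin m) (Fin m) (Matrix (Fin n) (Fin n) A) ≃⋆ₐ[ℝ]
      Matrix (Fin N) (Fin N) A) :=
  ⟨(compStarAlgEquiv (Fin m) (Fin n) A).trans
    (reindexStarAlgEquiv A (finProdFinEquiv.trans (finCongr h)))⟩

end Matrix

section prod

variable {A A' B B' : Type*} [Ring A] [StarRing A] [Algebra ℝ A] [Ring B] [StarRing B]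
  [Algebra ℝ B] [Ring A'] [StarRing A'] [Algebra ℝ A'] [Ring B'] [StarRing B'] [Algebra ℝ B']

/-- The product of two isomorphisms of star algebras. -/
def StarAlgEquiv.prodMap (f : A ≃⋆ₐ[ℝ] A') (g : B ≃⋆ₐ[ℝ] B') : (A × B) ≃⋆ₐ[ℝ] A' × B' where
  toFun x := (f x.1, g x.2)
  invFun x := (f.symm x.1, g.symm x.2)
  left_inv x := by simp
  right_inv x := by simp
  map_mul' x y := by simp
  map_add' x y := by simp
  map_star' x := by simp [Prod.star_def, map_star]
  map_smul' r x := by simp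

variable (A B) in
/-- A pair is unitary if and only if its components are. -/
def unitaryProdMulEquiv : unitary (A × B) ≃* unitary A × unitary B where
  toFun x := (⟨x.1.1, congrArg Prod.fst x.2.1, congrArg Prod.fst x.2.2⟩,
    ⟨x.1.2, congrArg Prod.snd x.2.1, congrArg Prod.snd x.2.2⟩)
  invFun x := ⟨(x.1, x.2), Prod.ext x.1.2.1 x.2.2.1, Prod.ext x.1.2.2 x.2.2.2⟩
  left_inv _ := rfl
  right_inv _ := rfl
  map_mul' _ _ := rfl

/-- The isomorphism of unitary groups induced by an isomorphism of star algebras. -/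
def StarAlgEquiv.unitaryMulEquiv (f : A ≃⋆ₐ[ℝ] B) : unitary A ≃* unitary B where
  toFun x := ⟨f x, by
    rw [Unitary.mem_iff, ← map_star, ← map_mul, ← map_mul, (Unitary.mem_iff.1 x.2).1,
      (Unitary.mem_iff.1 x.2).2, map_one]
    exact ⟨rfl, rfl⟩⟩
  invFun x := ⟨f.symm x, by
    rw [Unitary.mem_iff, ← map_star, ← map_mul, ← map_mul, (Unitary.mem_iff.1 x.2).1,
      (Unitary.mem_iff.1 x.2).2, map_one]
    exact ⟨rfl, rfl⟩⟩
  left_inv x := Subtype.ext (f.symm_apply_apply _)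
  right_inv x := Subtype.ext (f.apply_symm_apply _)
  map_mul' x y := Subtype.ext (map_mul f _ _)

end prod

/-! ### Models for all n: base cases and periodicity -/

/-- The star algebra `A` is isomorphic to the Clifford algebra of a definite form of rank `n`. -/
def HasCliffordSystem (n : ℕ) (A : Type*) [Ring A] [StarRing A] [Algebra ℝ A] : Prop :=
  ∃ e : Fin n → A, CliffordSystem e

namespace HasCliffordSystem

section

variable {n : ℕ} {A B : Type*} [Ring A] [StarRing A] [Algebra ℝ A] [Ring B] [StarRing B]
  [Algebra ℝ B]

theorem congr (h : HasCliffordSystem n A) (φ : A ≃⋆ₐ[ℝ] B) : HasCliffordSystem n B :=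
  let ⟨_, he⟩ := h
  ⟨_, he.map φ⟩

theorem add_four (h : HasCliffordSystem n A) [Module.Finite ℝ A] [Module.Finite ℝ B]
    {a : ℍ[ℝ] →⋆ₐ[ℝ] B} {b : A →⋆ₐ[ℝ] B} (hab : QuaternionExtension a b) :
    HasCliffordSystem (n + 4) (Matrix (Fin 2) (Fin 2) B) :=
  let ⟨_, he⟩ := h
  ⟨_, (he.quaternionicExtension hab).reindex finSumFinEquiv.symm⟩

end

section

variable {n N : ℕ} {A A' B B' : Type*} [Ring A] [StarRing A] [Algebra ℝ A] [Ring B] [StarRing B]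
  [Algebra ℝ B] [Ring A'] [StarRing A'] [Algebra ℝ A'] [Ring B'] [StarRing B'] [Algebra ℝ B']
  [Module.Finite ℝ A] [Module.Finite ℝ B] [Module.Finite ℝ A'] [Module.Finite ℝ B']
  {a : ℍ[ℝ] →⋆ₐ[ℝ] B} {b : A →⋆ₐ[ℝ] B} {a' : ℍ[ℝ] →⋆ₐ[ℝ] B'} {b' : A' →⋆ₐ[ℝ] B'}

theorem matrix_add_four (h : HasCliffordSystem n (Matrix (Fin N) (Fin N) A))
    (hab : QuaternionExtension a b) :
    HasCliffordSystem (n + 4) (Matrix (Fin (2 * N)) (Fin (2 * N)) B) :=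
  let ⟨φ⟩ := Matrix.nonempty_finStarAlgEquiv B (rfl : 2 * N = 2 * N)
  (h.add_four (hab.matrix (Fin N))).congr φ

theorem prod_matrix_add_four
    (h : HasCliffordSystem n (Matrix (Fin N) (Fin N) A × Matrix (Fin N) (Fin N) A'))
    (hab : QuaternionExtension a b) (hab' : QuaternionExtension a' b') :
    HasCliffordSystem (n + 4)
      (Matrix (Fin (2 * N)) (Fin (2 * N)) B × Matrix (Fin (2 * N)) (Fin (2 * N)) B') :=
  let ⟨φ⟩ := Matrix.nonempty_finStarAlgEquiv B (rfl : 2 * N = 2 * N)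
  let ⟨φ'⟩ := Matrix.nonempty_finStarAlgEquiv B' (rfl : 2 * N = 2 * N)
  (h.add_four ((hab.matrix (Fin N)).prod (hab'.matrix (Fin N)))).congr
    ((Matrix.prodStarAlgEquiv _ _ _).trans (φ.prodMap φ'))

end

section bases

theorem zero_real : HasCliffordSystem 0 ℝ :=
  ⟨Fin.elim0,
    { sq := fun i => i.elim0
      anticomm := fun i => i.elim0
      star_eq := fun i => i.elim0
      generates := fun S _ => eq_top_iff.2 fun x _ => S.algebraMap_mem x
      finrank_eq := by simp }⟩

theorem one_complex : HasCliffordSystem 1 ℂ :=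
  ⟨fun _ => Complex.I,
    { sq := fun _ => Complex.I_mul_I
      anticomm := fun i j h => absurd (Subsingleton.elim i j) h
      star_eq := fun _ => Complex.conj_I
      generates := fun S hS => eq_top_iff.2 fun x _ => by
        rw [← Complex.re_add_im x]
        refine S.add_mem (S.algebraMap_mem x.re) (S.mul_mem (S.algebraMap_mem x.im) (hS 0))
      finrank_eq := by simp }⟩

theorem two_quaternion : HasCliffordSystem 2 ℍ[ℝ] := by
  refine ⟨![quaternionOf 0 1 0 0, quaternionOf 0 0 1 0], ?_, ?_, ?_, fun S hS => ?_, ?_⟩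
  · intro i
    fin_cases i <;> ext <;> simp
  · intro i j h
    fin_cases i <;> fin_cases j <;> first | exact absurd rfl h | (ext <;> simp)
  · intro i
    fin_cases i <;> ext <;> simp
  · have hi : quaternionOf 0 1 0 0 ∈ S := hS 0
    have hj : quaternionOf 0 0 1 0 ∈ S := hS 1
    refine eq_top_iff.2 fun q _ => ?_
    have hq : q = q.re • (1 : ℍ[ℝ]) + q.imI • quaternionOf 0 1 0 0 + q.imJ • quaternionOf 0 0 1 0
        + q.imK • (quaternionOf 0 1 0 0 * quaternionOf 0 0 1 0) := by
      ext <;> simp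
    rw [hq]
    exact add_mem (add_mem (add_mem (S.smul_mem S.one_mem _) (S.smul_mem hi _))
      (S.smul_mem hj _)) (S.smul_mem (S.mul_mem hi hj) _)
  · rw [Quaternion.finrank_eq_four]; simp

/-- The opposite signs make ijk equal to (-1, 1), which separates the factors; with equal signs only
the diagonal copy of ℍ would be generated. -/
theorem three_quaternion_prod : HasCliffordSystem 3 (ℍ[ℝ] × ℍ[ℝ]) := by
  let I := quaternionOf 0 1 0 0
  let J := quaternionOf 0 0 1 0
  let K := quaternionOf 0 0 0 1
  refine ⟨![(I, -I), (J, -J), (K, -K)], ?_, ?_, ?_, fun S hS => ?_, ?_⟩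
  · intro i
    fin_cases i <;> ext <;> simp [I, J, K]
  · intro i j h
    fin_cases i <;> fin_cases j <;> first | exact absurd rfl h | (ext <;> simp [I, J, K])
  · intro i
    fin_cases i <;> ext <;> simp [I, J, K]
  · have hI : (I, -I) ∈ S := hS 0
    have hJ : (J, -J) ∈ S := hS 1
    have hK : (K, -K) ∈ S := hS 2
    have hd : ((1, -1) : ℍ[ℝ] × ℍ[ℝ]) ∈ S := by
      convert S.neg_mem (S.mul_mem (S.mul_mem hI hJ) hK) using 1
      ext <;> simp [I, J, K]
    have h10 : ((1, 0) : ℍ[ℝ] × ℍ[ℝ]) ∈ S := by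
      convert S.smul_mem (S.add_mem S.one_mem hd) (1 / 2 : ℝ) using 1
      ext <;> (simp; try norm_num)
    have h01 : ((0, 1) : ℍ[ℝ] × ℍ[ℝ]) ∈ S := by
      convert S.sub_mem S.one_mem h10 using 1
      ext <;> simp
    refine eq_top_iff.2 fun q _ => ?_
    have hq : q = (1, 0) * (q.1.re • 1 + q.1.imI • (I, -I) + q.1.imJ • (J, -J)
          + q.1.imK • (K, -K))
        + (0, 1) * (q.2.re • 1 - q.2.imI • (I, -I) - q.2.imJ • (J, -J)
          - q.2.imK • (K, -K)) := by
      ext <;> simp [I, J, K]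
    rw [hq]
    have h1 := S.one_mem
    exact add_mem
      (S.mul_mem h10 (add_mem (add_mem (add_mem (S.smul_mem h1 _) (S.smul_mem hI _))
        (S.smul_mem hJ _)) (S.smul_mem hK _)))
      (S.mul_mem h01 (sub_mem (sub_mem (sub_mem (S.smul_mem h1 _) (S.smul_mem hI _))
        (S.smul_mem hJ _)) (S.smul_mem hK _)))
  · rw [finrank_prod, Quaternion.finrank_eq_four]; simp

end bases

section step

variable {n N M : ℕ}

theorem quaternion_of_real (h : HasCliffordSystem n (Matrix (Fin N) (Fin N) ℝ)) (hM : 2 * N = M) :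
    HasCliffordSystem (n + 4) (Matrix (Fin M) (Fin M) ℍ[ℝ]) :=
  hM ▸ h.matrix_add_four QuaternionExtension.real

/-- The factor 2 in the size comes from the 2 × 2 blocks, the factor 4 from ℍ ⊗ ℍ = M₄(ℝ). -/
theorem real_of_quaternion (h : HasCliffordSystem n (Matrix (Fin N) (Fin N) ℍ[ℝ]))
    (hM : 2 * N * 4 = M) : HasCliffordSystem (n + 4) (Matrix (Fin M) (Fin M) ℝ) :=
  let ⟨φ⟩ := Matrix.nonempty_finStarAlgEquiv ℝ hM
  (h.matrix_add_four QuaternionExtension.quaternion).congr φ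

theorem complex_of_complex (h : HasCliffordSystem n (Matrix (Fin N) (Fin N) ℂ))
    (hM : 2 * N * 2 = M) : HasCliffordSystem (n + 4) (Matrix (Fin M) (Fin M) ℂ) :=
  let ⟨φ⟩ := Matrix.nonempty_finStarAlgEquiv ℂ hM
  (h.matrix_add_four QuaternionExtension.complex).congr φ

theorem quaternion_prod_of_real_prod
    (h : HasCliffordSystem n (Matrix (Fin N) (Fin N) ℝ × Matrix (Fin N) (Fin N) ℝ))
    (hM : 2 * N = M) :
    HasCliffordSystem (n + 4) (Matrix (Fin M) (Fin M) ℍ[ℝ] × Matrix (Fin M) (Fin M) ℍ[ℝ]) :=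
  hM ▸ h.prod_matrix_add_four QuaternionExtension.real QuaternionExtension.real

theorem real_prod_of_quaternion_prod
    (h : HasCliffordSystem n (Matrix (Fin N) (Fin N) ℍ[ℝ] × Matrix (Fin N) (Fin N) ℍ[ℝ]))
    (hM : 2 * N * 4 = M) :
    HasCliffordSystem (n + 4) (Matrix (Fin M) (Fin M) ℝ × Matrix (Fin M) (Fin M) ℝ) :=
  let ⟨φ⟩ := Matrix.nonempty_finStarAlgEquiv ℝ hM
  (h.prod_matrix_add_four QuaternionExtension.quaternion QuaternionExtension.quaternion).congr
    (φ.prodMap φ)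

end step

section periodicity

theorem eight_mul (k : ℕ) :
    HasCliffordSystem (8 * k) (Matrix (Fin (2 ^ (4 * k))) (Fin (2 ^ (4 * k))) ℝ) := by
  induction k with
  | zero => exact zero_real.congr (Matrix.finOneStarAlgEquiv ℝ).symm
  -- The two steps add 4 + 4 to the index and multiply the size by 2 · 2 · 4 = 2^4.
  | succ k ih => exact (ih.quaternion_of_real rfl).real_of_quaternion (by ring)

theorem eight_mul_add_one (k : ℕ) :
    HasCliffordSystem (8 * k + 1) (Matrix (Fin (2 ^ (4 * k))) (Fin (2 ^ (4 * k))) ℂ) := by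
  induction k with
  | zero => exact one_complex.congr (Matrix.finOneStarAlgEquiv ℂ).symm
  | succ k ih => exact (ih.complex_of_complex rfl).complex_of_complex (by ring)

theorem eight_mul_add_two (k : ℕ) :
    HasCliffordSystem (8 * k + 2) (Matrix (Fin (2 ^ (4 * k))) (Fin (2 ^ (4 * k))) ℍ[ℝ]) := by
  induction k with
  | zero => exact two_quaternion.congr (Matrix.finOneStarAlgEquiv ℍ[ℝ]).symm
  | succ k ih => exact (ih.real_of_quaternion rfl).quaternion_of_real (by ring)

theorem eight_mul_add_three (k : ℕ) :
    HasCliffordSystem (8 * k + 3) (Matrix (Fin (2 ^ (4 * k))) (Fin (2 ^ (4 * k))) ℍ[ℝ] ×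
      Matrix (Fin (2 ^ (4 * k))) (Fin (2 ^ (4 * k))) ℍ[ℝ]) := by
  induction k with
  | zero =>
    exact three_quaternion_prod.congr
      ((Matrix.finOneStarAlgEquiv ℍ[ℝ]).symm.prodMap
        (Matrix.finOneStarAlgEquiv ℍ[ℝ]).symm)
  | succ k ih => exact (ih.real_prod_of_quaternion_prod rfl).quaternion_prod_of_real_prod (by ring)

theorem eight_mul_add_four (k : ℕ) :
    HasCliffordSystem (8 * k + 4)
      (Matrix (Fin (2 ^ (4 * k + 1))) (Fin (2 ^ (4 * k + 1))) ℍ[ℝ]) :=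
  (eight_mul k).quaternion_of_real (by ring)

theorem eight_mul_add_five (k : ℕ) :
    HasCliffordSystem (8 * k + 5)
      (Matrix (Fin (2 ^ (4 * k + 2))) (Fin (2 ^ (4 * k + 2))) ℂ) :=
  (eight_mul_add_one k).complex_of_complex (by ring)

theorem eight_mul_add_six (k : ℕ) :
    HasCliffordSystem (8 * k + 6)
      (Matrix (Fin (2 ^ (4 * k + 3))) (Fin (2 ^ (4 * k + 3))) ℝ) :=
  (eight_mul_add_two k).real_of_quaternion (by ring)

theorem eight_mul_add_seven (k : ℕ) :
    HasCliffordSystem (8 * k + 7) (Matrix (Fin (2 ^ (4 * k + 3))) (Fin (2 ^ (4 * k + 3))) ℝ ×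
      Matrix (Fin (2 ^ (4 * k + 3))) (Fin (2 ^ (4 * k + 3))) ℝ) :=
  (eight_mul_add_three k).real_prod_of_quaternion_prod (by ring)

end periodicity

/-! ### Passage to unitary groups and the theorem -/

section unitary

variable {n : ℕ} {A B : Type*} [Ring A] [StarRing A] [Algebra ℝ A] [StarModule ℝ A]
  [Ring B] [StarRing B] [Algebra ℝ B] [StarModule ℝ B]
  {Q : QuadraticForm ℝ (Fin n → ℝ)}

theorem nonempty_mulEquiv (h : HasCliffordSystem n A) (hQ : Q.PosDef) :
    Nonempty (cliffordIsometryGroup Q ≃* unitary A) :=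
  let ⟨_, he⟩ := h
  let ⟨φ⟩ := (he.nonempty_starAlgEquiv hQ).2
  ⟨φ.unitaryMulEquiv⟩

theorem nonempty_mulEquiv_prod (h : HasCliffordSystem n (A × B)) (hQ : Q.PosDef) :
    Nonempty (cliffordIsometryGroup Q ≃* unitary A × unitary B) :=
  let ⟨φ⟩ := h.nonempty_mulEquiv hQ
  ⟨φ.trans (unitaryProdMulEquiv A B)⟩

theorem isCompact (h : HasCliffordSystem n A) (hA : HasFrobeniusForm A) (hQ : Q.PosDef) :
    IsCompact (cliffordIsometryGroup Q : Set (Cl Q)) := by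
  obtain ⟨_, he⟩ := h
  obtain ⟨_, ⟨φ⟩⟩ := he.nonempty_starAlgEquiv hQ
  have : StarModule ℝ (Cl Q) := ⟨fun r x => CliffordAlgebra.star_smul r x⟩
  exact (hA.of_starAlgEquiv φ).isCompact_unitary

end unitary

end HasCliffordSystem

theorem isCompact_cliffordIsometryGroup {n : ℕ} {Q : QuadraticForm ℝ (Fin n → ℝ)}
    (hQ : Q.PosDef) : IsCompact (cliffordIsometryGroup Q : Set (Cl Q)) := by
  obtain ⟨k, r, hr, rfl⟩ : ∃ k r, r < 8 ∧ n = 8 * k + r :=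
    ⟨n / 8, n % 8, Nat.mod_lt _ (by norm_num), (Nat.div_add_mod n 8).symm⟩
  interval_cases r
  · exact (HasCliffordSystem.eight_mul k).isCompact (.matrix .real _) hQ
  · exact (HasCliffordSystem.eight_mul_add_one k).isCompact (.matrix .complex _) hQ
  · exact (HasCliffordSystem.eight_mul_add_two k).isCompact (.matrix .quaternion _) hQ
  · exact (HasCliffordSystem.eight_mul_add_three k).isCompact
      (.prod (.matrix .quaternion _) (.matrix .quaternion _)) hQ
  · exact (HasCliffordSystem.eight_mul_add_four k).isCompact (.matrix .quaternion _) hQ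
  · exact (HasCliffordSystem.eight_mul_add_five k).isCompact (.matrix .complex _) hQ
  · exact (HasCliffordSystem.eight_mul_add_six k).isCompact (.matrix .real _) hQ
  · exact (HasCliffordSystem.eight_mul_add_seven k).isCompact
      (.prod (.matrix .real _) (.matrix .real _)) hQ

theorem theorem9p5 :
    (∀ k : ℕ,
      (∀ Q : QuadraticForm ℝ (Fin (8 * k) → ℝ), Q.PosDef →
        Nonempty (cliffordIsometryGroup Q ≃* Matrix.orthogonalGroup (Fin (2 ^ (4 * k))) ℝ)) ∧
      (∀ Q : QuadraticForm ℝ (Fin (8 * k + 1) → ℝ), Q.PosDef →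
        Nonempty (cliffordIsometryGroup Q ≃* Matrix.unitaryGroup (Fin (2 ^ (4 * k))) ℂ)) ∧
      (∀ Q : QuadraticForm ℝ (Fin (8 * k + 2) → ℝ), Q.PosDef →
        Nonempty (cliffordIsometryGroup Q ≃* compactSymplecticGroup (2 ^ (4 * k)))) ∧
      (∀ Q : QuadraticForm ℝ (Fin (8 * k + 3) → ℝ), Q.PosDef →
        Nonempty (cliffordIsometryGroup Q ≃*
          compactSymplecticGroup (2 ^ (4 * k)) × compactSymplecticGroup (2 ^ (4 * k)))) ∧
      (∀ Q : QuadraticForm ℝ (Fin (8 * k + 4) → ℝ), Q.PosDef →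
        Nonempty (cliffordIsometryGroup Q ≃* compactSymplecticGroup (2 ^ (4 * k + 1)))) ∧
      (∀ Q : QuadraticForm ℝ (Fin (8 * k + 5) → ℝ), Q.PosDef →
        Nonempty (cliffordIsometryGroup Q ≃* Matrix.unitaryGroup (Fin (2 ^ (4 * k + 2))) ℂ)) ∧
      (∀ Q : QuadraticForm ℝ (Fin (8 * k + 6) → ℝ), Q.PosDef →
        Nonempty (cliffordIsometryGroup Q ≃*
          Matrix.orthogonalGroup (Fin (2 ^ (4 * k + 3))) ℝ)) ∧
      (∀ Q : QuadraticForm ℝ (Fin (8 * k + 7) → ℝ), Q.PosDef →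
        Nonempty (cliffordIsometryGroup Q ≃*
          Matrix.orthogonalGroup (Fin (2 ^ (4 * k + 3))) ℝ ×
            Matrix.orthogonalGroup (Fin (2 ^ (4 * k + 3))) ℝ))) ∧
    (∀ (n : ℕ) (Q : QuadraticForm ℝ (Fin n → ℝ)), Q.PosDef →
      IsCompact (cliffordIsometryGroup Q : Set (Cl Q))) :=
  ⟨fun k =>
    ⟨fun _ hQ => (HasCliffordSystem.eight_mul k).nonempty_mulEquiv hQ,
      fun _ hQ => (HasCliffordSystem.eight_mul_add_one k).nonempty_mulEquiv hQ,
      fun _ hQ => (HasCliffordSystem.eight_mul_add_two k).nonempty_mulEquiv hQ,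
      fun _ hQ => (HasCliffordSystem.eight_mul_add_three k).nonempty_mulEquiv_prod hQ,
      fun _ hQ => (HasCliffordSystem.eight_mul_add_four k).nonempty_mulEquiv hQ,
      fun _ hQ => (HasCliffordSystem.eight_mul_add_five k).nonempty_mulEquiv hQ,
      fun _ hQ => (HasCliffordSystem.eight_mul_add_six k).nonempty_mulEquiv hQ,
      fun _ hQ => (HasCliffordSystem.eight_mul_add_seven k).nonempty_mulEquiv_prod hQ⟩,
    fun _ _ hQ => isCompact_cliffordIsometryGroup hQ⟩
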